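/- Let $\Delta>0$ and let $S$ be a qubit with Hamiltonian $H_S=\frac{\Delta}{2}\sigma^z$. For a finite-dimensional system with Hamiltonian $H$, a translationally invariant operation (TIO) is a completely positive trace-preserving map $\mathcal E$ with $\mathcal E(e^{-iHt}Xe^{iHt})=e^{-iHt}\mathcal E(X)e^{iHt}$ for all $t\in\mathbb R$ and all operators $X$. A state $\rho$ of $S$ can be transformed to a state $\rho'$ of $S$ by a correlating-catalytic TIO if there are a finite-dimensional system $C$ with some Hamiltonian $H_C$, a state $\sigma$ of $C$, and a TIO $\mathcal E$ on $S\otimes C$ with respect to the Hamiltonian $H_S\otimes\mathbb 1+\mathbb 1\otimes H_C$, such that the (possibly correlated) state $\mathcal E(\rho\otimes\sigma)$ has reduced state $\rho'$ on $S$ and reduced state $\sigma$ on $C$. Let $\rho^+=\frac12(\mathbb 1+\sigma^x)$, where $\sigma^x,\sigma^z$ are the Pauli matrices. Then a state $\rho$ of $S$ can be transformed exactly to $\rho^+$ by a correlating-catalytic TIO if and only if $\rho$ is equivalent to $\rho^+$ under a symmetric unitary, that is, $\rho=U\rho^+U^\dagger$ for some unitary $U$ with $[U,H_S]=0$. In particular,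 no finite-dimensional correlating catalyst and global TIO can map any other state exactly to $\rho^+$. -/

import Mathlib

open scoped Kronecker ComplexOrder

/-- A density matrix (quantum state) on the Hilbert space `ℂⁿ`: positive semidefinite, trace one. -/
def IsDensityMatrix {n : Type*} [Fintype n] (ρ : Matrix n n ℂ) : Prop :=
  ρ.PosSemidef ∧ ρ.trace = 1

/-- The reduced state on the first tensor factor: the partial trace over the second one. -/
def reducedLeft {m n : Type*} [Fintype n] (X : Matrix (m × n) (m × n) ℂ) : Matrix m m ℂ :=
  Matrix.of fun i j => ∑ k, X (i, k) (j, k)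

/-- The reduced state on the second tensor factor: the partial trace over the first one. -/
def reducedRight {m n : Type*} [Fintype m] (X : Matrix (m × n) (m × n) ℂ) : Matrix n n ℂ :=
  Matrix.of fun i j => ∑ k, X (k, i) (k, j)

section CompletePositivity

open scoped CStarAlgebra MatrixOrder Matrix.Norms.L2Operator

/-- Complete positivity of a linear map on the full matrix algebra, in the C⋆-algebraic sense:
the C⋆-structure of `Matrix n n ℂ` is the operator norm on `ℂⁿ`, its order is the Loewner order
(`0 ≤ X` means that `X` is positive semidefinite). -/
def IsCompletelyPositive {n : Type*} [Fintype n] [DecidableEq n]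
    (E : Matrix n n ℂ →ₗ[ℂ] Matrix n n ℂ) : Prop :=
  ∃ Φ : Matrix n n ℂ →CP Matrix n n ℂ, Φ.toLinearMap = E

/-- A `k × k` matrix of `n × n` matrices as one `(k × n) × (k × n)` matrix. -/
def flattenBlocks {k n : Type*} (M : CStarMatrix k k (Matrix n n ℂ)) : Matrix (k × n) (k × n) ℂ :=
  Matrix.of fun p q => M p.1 q.1 p.2 q.2

lemma nonneg_iff_posSemidef_flattenBlocks {k n : Type*} [Fintype k] [DecidableEq k] [Fintype n] [DecidableEq n]
   (M : CStarMatrix k k (Matrix n n ℂ)) : 0 ≤ M ↔ (flattenBlocks M).PosSemidef := by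
  have key : ∀ N : CStarMatrix k k (Matrix n n ℂ), flattenBlocks (star N * N) = star (flattenBlocks N) * flattenBlocks N := by
    intro N
    ext p q
    simp [flattenBlocks, CStarMatrix.mul_apply, Matrix.mul_apply, CStarMatrix.star_apply, Matrix.star_apply, Fintype.sum_prod_type, Matrix.sum_apply]
  constructor
  · intro h
    rw [StarOrderedRing.nonneg_iff] at h
    induction h using AddSubmonoid.closure_induction with
    | mem x hx =>
      obtain ⟨N, rfl⟩ := hx
      change (flattenBlocks (star N * N)).PosSemidef
      rw [key]
      exact Matrix.posSemidef_conjTranspose_mul_self _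
    | zero => exact Matrix.PosSemidef.zero
    | add x y _ _ h1 h2 => exact h1.add h2
  · intro h
    obtain ⟨B, hB⟩ := CStarAlgebra.nonneg_iff_eq_star_mul_self.mp h.nonneg
    let N : CStarMatrix k k (Matrix n n ℂ) := CStarMatrix.ofMatrix (fun a b => Matrix.of fun i j => B (a,i) (b,j))
    have : M = star N * N := by
      have h1 : flattenBlocks M = flattenBlocks (star N * N) := by rw [key]; exact hB
      ext a b i j
      exact congrFun (congrFun h1 (a,i)) (b,j)
    rw [this]; exact star_mul_self_nonneg N

/-- `E` is completely positive iff all its extensions `id_k ⊗ E` preserve positive semidefiniteness. -/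
theorem isCompletelyPositive_iff {n : Type*} [Fintype n] [DecidableEq n]
    (E : Matrix n n ℂ →ₗ[ℂ] Matrix n n ℂ) : IsCompletelyPositive E ↔
    ∀ (k : ℕ) (M : Matrix (Fin k × n) (Fin k × n) ℂ), M.PosSemidef →
      (Matrix.of fun p q : Fin k × n =>
        E (Matrix.of fun i j => M (p.1, i) (q.1, j)) p.2 q.2).PosSemidef := by
  constructor
  · rintro ⟨Φ, rfl⟩ k M hM
    let N : CStarMatrix (Fin k) (Fin k) (Matrix n n ℂ) := CStarMatrix.ofMatrix (fun a b => Matrix.of fun i j => M (a,i) (b,j))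
    exact (nonneg_iff_posSemidef_flattenBlocks _).1 (Φ.map_cstarMatrix_nonneg' k N ((nonneg_iff_posSemidef_flattenBlocks N).2 hM))
  · intro h
    refine ⟨⟨E, fun k M hM => ?_⟩, rfl⟩
    exact (nonneg_iff_posSemidef_flattenBlocks _).2 (h k _ ((nonneg_iff_posSemidef_flattenBlocks M).1 hM))

end CompletePositivity

/-- A quantum operation on `ℂⁿ`: a completely positive and trace-preserving linear map. -/
def IsQuantumOperation {n : Type*} [Fintype n] [DecidableEq n]
    (E : Matrix n n ℂ →ₗ[ℂ] Matrix n n ℂ) : Prop :=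
  IsCompletelyPositive E ∧ ∀ X, (E X).trace = X.trace

/-- The free evolution `X ↦ e^{-iHt} X e^{iHt}` generated by the Hamiltonian `H`. -/
noncomputable def freeEvolution {n : Type*} [Fintype n] [DecidableEq n]
    (H : Matrix n n ℂ) (t : ℝ) (X : Matrix n n ℂ) : Matrix n n ℂ :=
  NormedSpace.exp ((-(Complex.I * (t : ℂ))) • H) * X * NormedSpace.exp ((Complex.I * (t : ℂ)) • H)

/-- A translationally invariant operation (TIO) with respect to the Hamiltonian `H`: a quantum
operation that commutes with the free evolution at all times. -/
def IsTIO {n : Type*} [Fintype n] [DecidableEq n]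
    (H : Matrix n n ℂ) (E : Matrix n n ℂ →ₗ[ℂ] Matrix n n ℂ) : Prop :=
  IsQuantumOperation E ∧ ∀ (t : ℝ) (X : Matrix n n ℂ),
    E (freeEvolution H t X) = freeEvolution H t (E X)

/-- The Hamiltonian `H_S + H_C`, that is `H_S ⊗ 1 + 1 ⊗ H_C`, of two non-interacting systems. -/
def totalHamiltonian {m n : Type*} [DecidableEq m] [DecidableEq n]
    (HS : Matrix m m ℂ) (HC : Matrix n n ℂ) : Matrix (m × n) (m × n) ℂ :=
  HS ⊗ₖ (1 : Matrix n n ℂ) + (1 : Matrix m m ℂ) ⊗ₖ HC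

/-- `ρ` can be transformed to `ρ'` by a correlating-catalytic TIO: for some finite-dimensional
catalyst (dimension `d`, Hamiltonian `HC`, state `σ`) some global TIO maps `ρ ⊗ σ` to a bipartite
state, possibly correlated, with reduced states `ρ'` on the system and `σ` on the catalyst. -/
def CCTIOConvertible {m : Type*} [Fintype m] [DecidableEq m]
    (HS ρ ρ' : Matrix m m ℂ) : Prop :=
  ∃ (d : ℕ) (HC σ : Matrix (Fin d) (Fin d) ℂ)
    (E : Matrix (m × Fin d) (m × Fin d) ℂ →ₗ[ℂ] Matrix (m × Fin d) (m × Fin d) ℂ),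
    HC.IsHermitian ∧ IsDensityMatrix σ ∧ IsTIO (totalHamiltonian HS HC) E ∧
      reducedLeft (E (ρ ⊗ₖ σ)) = ρ' ∧ reducedRight (E (ρ ⊗ₖ σ)) = σ

/-- `ρ` and `ρ'` are equivalent under a symmetric unitary, i.e. one that commutes with `H`. -/
def SymmetricUnitaryEquivalent {n : Type*} [Fintype n] [DecidableEq n]
    (H ρ ρ' : Matrix n n ℂ) : Prop :=
  ∃ U ∈ Matrix.unitaryGroup n ℂ, Commute U H ∧ ρ = U * ρ' * star U

/-- The Pauli matrix `σˣ`. -/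
def pauliX : Matrix (Fin 2) (Fin 2) ℂ := !![0, 1; 1, 0]

/-- The Pauli matrix `σᶻ`. -/
def pauliZ : Matrix (Fin 2) (Fin 2) ℂ := !![1, 0; 0, -1]

/-- The qubit Hamiltonian `(Δ / 2) σᶻ` with energy gap `Δ`. -/
noncomputable def qubitHamiltonian (Δ : ℝ) : Matrix (Fin 2) (Fin 2) ℂ :=
  ((Δ / 2 : ℝ) : ℂ) • pauliZ

/-- The maximally asymmetric qubit state `ρ⁺ = (1 + σˣ) / 2`. -/
noncomputable def rhoPlus : Matrix (Fin 2) (Fin 2) ℂ :=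
  (1 / 2 : ℂ) • (1 + pauliX)

/-!
The symmetric logarithmic derivative (SLD) quantum Fisher information of a state `τ` with respect
to a Hamiltonian `H` is `F(τ) = tr (τ L²)`, where `L` is Hermitian and solves
`(L τ + τ L) / 2 = -i [H, τ]`. It obstructs exact conversion because it is finite in finite
dimension, additive on product states of non-interacting systems, and monotone under
translationally invariant operations.

Monotonicity is used in the variational form
`tr (E(L τ + τ L) X) - tr (E(τ) X²) ≤ F(τ)` for every Hermitian `X`
(`IsQuantumOperation.trace_variational`), which follows from complete positivity on `2 × 2` block
matrices. Differentiating the covariance condition (`IsTIO.map_commutator`) identifies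
`E(L τ + τ L)` with `-2 i [H, E(τ)]`. For `τ = ρ ⊗ σ` and `X = L' ⊗ 1 + 1 ⊗ Lσ`, with `L'` and
`Lσ` logarithmic derivatives of the target and of the catalyst, the left-hand side involves the
output only through its reduced states, except for the correlation term
`tr (E(ρ ⊗ σ) (L' ⊗ Lσ))`. This term vanishes because the target is pure
(`trace_mul_kronecker_eq_zero`). The finite number `F(σ)` then cancels, which leaves
`F(ρ') ≤ F(ρ)` (`CCTIOConvertible.fisher_le`).

For a qubit `F(ρ) = 4 Δ² |ρ₀₁|²`, so a state convertible to `ρ⁺` has `|ρ₀₁| ≥ 1/2`. Positivity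
then forces `ρ₀₀ = ρ₁₁ = |ρ₀₁| = 1/2`, and `diag (2 ρ₀₁, 1)` carries `ρ⁺` to `ρ`. Conversely,
conjugation by a symmetric unitary is translationally invariant, and a one-dimensional catalyst
is enough.
-/

open Complex Matrix

/-! ### Partial traces -/

lemma reducedLeft_kronecker {m n : Type*} [Fintype n] (A : Matrix m m ℂ)
    (B : Matrix n n ℂ) :
    reducedLeft (A ⊗ₖ B) = B.trace • A := by
  ext i j
  simp [reducedLeft, Matrix.trace, Finset.sum_mul, mul_comm (A i j)]

lemma reducedRight_kronecker {m n : Type*} [Fintype m] (A : Matrix m m ℂ)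
    (B : Matrix n n ℂ) :
    reducedRight (A ⊗ₖ B) = A.trace • B := by
  ext i j
  simp [reducedRight, Matrix.trace, Finset.sum_mul]

section PartialTrace

variable {m n : Type*} [Fintype m] [Fintype n]

lemma trace_mul_kronecker_one [DecidableEq n] (Y : Matrix (m × n) (m × n) ℂ) (A : Matrix m m ℂ) :
    (Y * (A ⊗ₖ (1 : Matrix n n ℂ))).trace = (reducedLeft Y * A).trace := by
  simp only [Matrix.trace, Matrix.diag, Matrix.mul_apply, Fintype.sum_prod_type, reducedLeft,
    kroneckerMap_apply, Matrix.one_apply, Matrix.of_apply, mul_ite, mul_one, mul_zero,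
    Finset.sum_ite_eq', Finset.mem_univ, if_true, Finset.sum_mul]
  exact Finset.sum_congr rfl fun _ _ => Finset.sum_comm

lemma trace_mul_one_kronecker [DecidableEq m] (Y : Matrix (m × n) (m × n) ℂ) (B : Matrix n n ℂ) :
    (Y * ((1 : Matrix m m ℂ) ⊗ₖ B)).trace = (reducedRight Y * B).trace := by
  simp only [Matrix.trace, Matrix.diag, Matrix.mul_apply, Fintype.sum_prod_type, reducedRight,
    kroneckerMap_apply, Matrix.one_apply, Matrix.of_apply, ite_mul, mul_ite, one_mul, zero_mul,
    mul_zero, Finset.sum_mul]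
  rw [Finset.sum_comm]
  refine Finset.sum_congr rfl fun j _ => ?_
  rw [Finset.sum_comm]
  conv_rhs => rw [Finset.sum_comm]
  rw [Finset.sum_comm]
  refine Finset.sum_congr rfl fun i _ => ?_
  rw [Finset.sum_comm]
  simp

end PartialTrace

/-! ### Positivity of quantum operations on block matrices -/

section CompletePositivity

variable {n : Type*} [Fintype n] [DecidableEq n]

/-- A completely positive map stays positive when its arguments are the blocks of a positive
semidefinite block matrix `Aᴴ τ A` and the resulting block matrix is compressed by the row `C`. -/
lemma IsCompletelyPositive.posSemidef_sum {E : Matrix n n ℂ →ₗ[ℂ] Matrix n n ℂ}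
    (hE : IsCompletelyPositive E) {τ : Matrix n n ℂ} (hτ : τ.PosSemidef) {k : ℕ}
    (A C : Fin k → Matrix n n ℂ) :
    (∑ a, ∑ b, C a * E ((A a)ᴴ * τ * A b) * (C b)ᴴ).PosSemidef := by
  let V : Matrix n (Fin k × n) ℂ := Matrix.of fun i p => A p.1 i p.2
  let W : Matrix n (Fin k × n) ℂ := Matrix.of fun i p => C p.1 i p.2
  have h := ((isCompletelyPositive_iff E).1 hE k _
    (hτ.conjTranspose_mul_mul_same V)).mul_mul_conjTranspose_same W
  have hV : ∀ a b : Fin k, (Matrix.of fun i j => (Vᴴ * τ * V) (a, i) (b, j))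
      = (A a)ᴴ * τ * A b := by
    intro a b
    ext i j
    simp [V, Matrix.mul_apply]
  simp only [hV] at h
  convert h using 1
  ext i j
  simp only [Matrix.sum_apply, Matrix.mul_apply (M := _ * _), Matrix.mul_apply (M := W),
    Matrix.mul_apply (M := C _), Fintype.sum_prod_type, W, Matrix.of_apply, conjTranspose_apply]
  rw [Finset.sum_comm]
  refine Finset.sum_congr rfl fun b _ => ?_
  rw [Finset.sum_comm]
  simp only [Finset.sum_mul]

/-- The variational inequality behind the monotonicity of the quantum Fisher information: it is
positivity of `E` on the blocks of `(L, 1)ᴴ τ (L, 1)`, compressed by the row `(1, -X)`. -/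
lemma IsQuantumOperation.trace_variational {E : Matrix n n ℂ →ₗ[ℂ] Matrix n n ℂ}
    (hE : IsQuantumOperation E) {τ L X : Matrix n n ℂ} (hτ : τ.PosSemidef)
    (hL : L.IsHermitian) (hX : X.IsHermitian) :
    0 ≤ (τ * (L * L)).trace - (E (L * τ + τ * L) * X).trace + (E τ * (X * X)).trace := by
  have h := (hE.1.posSemidef_sum hτ ![L, 1] ![1, -X]).trace_nonneg
  convert h using 1
  simp only [Fin.sum_univ_two, Matrix.cons_val_zero, Matrix.cons_val_one, hL.eq,
    conjTranspose_one, one_mul, mul_one, conjTranspose_neg, hX.eq, trace_add, hE.2, map_add,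
    add_mul, mul_neg, neg_mul, neg_neg, trace_neg]
  rw [Matrix.trace_mul_comm X (E (τ * L)), Matrix.mul_assoc X, Matrix.trace_mul_comm X,
    Matrix.mul_assoc (E τ), Matrix.mul_assoc L, Matrix.trace_mul_comm L, Matrix.mul_assoc τ]
  ring

end CompletePositivity

/-! ### Infinitesimal covariance -/

section Covariance

variable {n : Type*} [Fintype n] [DecidableEq n]

open scoped Matrix.Norms.Operator in
lemma hasDerivAt_freeEvolution (H X : Matrix n n ℂ) :
    HasDerivAt (fun t : ℝ => freeEvolution H t X) (I • (X * H - H * X)) 0 := by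
  have h1 := (hasDerivAt_exp_smul_const (𝕂 := ℝ) (-I • H) 0).mul_const X
  have h2 := h1.mul (hasDerivAt_exp_smul_const (𝕂 := ℝ) (I • H) 0)
  have hf : (fun t : ℝ => freeEvolution H t X) =
      (fun t : ℝ => NormedSpace.exp (t • -I • H) * X) * fun t : ℝ => NormedSpace.exp (t • I • H) := by
    funext t
    have e1 : (-(I * (t : ℂ))) • H = t • -I • H := by ext; simp; ring
    have e2 : (I * (t : ℂ)) • H = t • I • H := by ext; simp; ring
    simp only [freeEvolution, Pi.mul_apply, e1, e2]
  rw [hf]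
  refine h2.congr_deriv ?_
  simp [sub_eq_add_neg, add_comm]

open scoped Matrix.Norms.Operator in
/-- Covariance under the evolution, in infinitesimal form. -/
lemma IsTIO.map_commutator {H : Matrix n n ℂ} {E : Matrix n n ℂ →ₗ[ℂ] Matrix n n ℂ}
    (hE : IsTIO H E) (X : Matrix n n ℂ) : E (X * H - H * X) = E X * H - H * E X := by
  have h1 := ((E.restrictScalars ℝ).toContinuousLinearMap.hasFDerivAt).comp_hasDerivAt (0 : ℝ)
    (hasDerivAt_freeEvolution H X)
  have h2 := hasDerivAt_freeEvolution H (E X)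
  have h3 := h1.unique (h2.congr_of_eventuallyEq (.of_forall fun t => hE.2 t X))
  have h4 : E (I • (X * H - H * X)) = I • (E X * H - H * E X) := h3
  rw [map_smul] at h4
  exact smul_right_injective _ I_ne_zero h4

end Covariance

/-! ### Symmetric logarithmic derivatives -/

section LogarithmicDerivative

/-- `L` is a symmetric logarithmic derivative of `τ` along the evolution generated by `H`: a
Hermitian matrix with `(L τ + τ L) / 2 = -i [H, τ]`. The quantum Fisher information of `τ` is
`tr (τ L²)`. -/
structure IsSLD {n : Type*} [Fintype n] (H τ L : Matrix n n ℂ) : Prop where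
  isHermitian : L.IsHermitian
  anticommutator : L * τ + τ * L = (2 * I) • (τ * H - H * τ)

variable {m n : Type*} [Fintype m] [DecidableEq m] [Fintype n] [DecidableEq n]

/-- In an eigenbasis of `τ` with eigenvalues `p i`, a symmetric logarithmic derivative has the
entries `2 i (p i - p j) / (p i + p j) * H i j`. -/
lemma exists_isSLD {H τ : Matrix n n ℂ} (hH : H.IsHermitian) (hτ : τ.PosSemidef) :
    ∃ L, IsSLD H τ L := by
  set U : Matrix n n ℂ := ↑hτ.1.eigenvectorUnitary with hU
  set p := hτ.1.eigenvalues with hp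
  have hUU : Uᴴ * U = 1 := (Matrix.mem_unitaryGroup_iff').1 hτ.1.eigenvectorUnitary.2
  have hUU' : U * Uᴴ = 1 := (Matrix.mem_unitaryGroup_iff).1 hτ.1.eigenvectorUnitary.2
  have hspec : τ = U * diagonal (fun i => (p i : ℂ)) * Uᴴ := by
    conv_lhs => rw [hτ.1.spectral_theorem]
    simp [Unitary.conjStarAlgAut_apply, hU, hp, Matrix.star_eq_conjTranspose, Function.comp_def]
  set D := diagonal (fun i => (p i : ℂ)) with hD
  set K := Uᴴ * H * U with hK
  have hKh : K.IsHermitian := isHermitian_conjTranspose_mul_mul U hH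
  have hHK : H = U * K * Uᴴ := by
    calc H = (U * Uᴴ) * H * (U * Uᴴ) := by rw [hUU']; simp
      _ = _ := by rw [hK]; simp only [Matrix.mul_assoc]
  let M : Matrix n n ℂ := Matrix.of fun i j =>
    2 * I * ((p i - p j : ℝ) / (p i + p j : ℝ) : ℂ) * K i j
  have hM : M.IsHermitian := by
    ext i j
    have := hKh.apply i j
    simp only [M, conjTranspose_apply, Matrix.of_apply, star_mul', this]
    simp only [RCLike.star_def, map_div₀, conj_ofReal, conj_I, map_ofNat]
    rw [add_comm (p j), ← neg_sub (p i)]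
    push_cast
    ring
  have hMD : M * D + D * M = (2 * I) • (D * K - K * D) := by
    ext i j
    simp only [M, hD, Matrix.add_apply, Matrix.sub_apply, Matrix.smul_apply, mul_diagonal,
      diagonal_mul, Matrix.of_apply, smul_eq_mul]
    -- if both eigenvalues vanish, the quotient is zero by convention and so are both sides
    by_cases h : p i + p j = 0
    · have h1 := hτ.eigenvalues_nonneg i
      have h2 := hτ.eigenvalues_nonneg j
      have h3 : p i = 0 := by simp only [hp] at *; linarith
      have h4 : p j = 0 := by simp only [hp] at *; linarith
      simp [h3, h4]
    · have h' : ((p i + p j : ℝ) : ℂ) ≠ 0 := by exact_mod_cast h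
      push_cast at h' ⊢
      field_simp
      ring
  have conj_mul : ∀ A B : Matrix n n ℂ, (U * A * Uᴴ) * (U * B * Uᴴ) = U * (A * B) * Uᴴ := by
    intro A B
    calc _ = U * A * (Uᴴ * U) * B * Uᴴ := by simp only [Matrix.mul_assoc]
      _ = _ := by rw [hUU]; simp only [Matrix.mul_one, Matrix.mul_assoc]
  refine ⟨U * M * Uᴴ, isHermitian_mul_mul_conjTranspose U hM, ?_⟩
  rw [hspec, hHK, conj_mul, conj_mul, conj_mul, conj_mul, ← Matrix.add_mul, ← Matrix.mul_add, hMD,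
    ← Matrix.sub_mul, ← Matrix.mul_sub]
  simp

/-- The logarithmic derivative has mean zero because the evolution preserves the trace. -/
lemma IsSLD.trace_mul_eq_zero {n : Type*} [Fintype n] {H τ L : Matrix n n ℂ}
    (h : IsSLD H τ L) : (τ * L).trace = 0 := by
  have := congrArg Matrix.trace h.anticommutator
  rw [trace_add, trace_smul, trace_sub, trace_mul_comm L, trace_mul_comm H, sub_self,
    smul_zero] at this
  simpa using this

lemma trace_commutator_mul {n : Type*} [Fintype n] (τ H L : Matrix n n ℂ) :
    (((2 * I) • (τ * H - H * τ)) * L).trace = 2 * I * (τ * (H * L - L * H)).trace := by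
  rw [smul_mul, trace_smul, Matrix.sub_mul, Matrix.mul_sub, trace_sub, trace_sub, smul_eq_mul,
    Matrix.mul_assoc, Matrix.mul_assoc H, Matrix.trace_mul_comm H, Matrix.mul_assoc τ L]

lemma IsSLD.trace_commutator {n : Type*} [Fintype n] {H τ L : Matrix n n ℂ}
    (h : IsSLD H τ L) : 2 * I * (τ * (H * L - L * H)).trace = 2 * (τ * (L * L)).trace := by
  rw [← trace_commutator_mul, ← h.anticommutator, Matrix.add_mul, trace_add, Matrix.mul_assoc,
    Matrix.trace_mul_comm L, Matrix.mul_assoc]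
  ring

lemma isHermitian_totalHamiltonian {m n : Type*} [DecidableEq m] [DecidableEq n]
    {A : Matrix m m ℂ} {B : Matrix n n ℂ} (hA : A.IsHermitian) (hB : B.IsHermitian) :
    (totalHamiltonian A B).IsHermitian := by
  simp [totalHamiltonian, Matrix.IsHermitian, conjTranspose_kronecker, hA.eq, hB.eq]

lemma IsSLD.kronecker {HA ρ LA : Matrix m m ℂ} {HB σ LB : Matrix n n ℂ} (hA : IsSLD HA ρ LA)
    (hB : IsSLD HB σ LB) :
    IsSLD (totalHamiltonian HA HB) (ρ ⊗ₖ σ) (totalHamiltonian LA LB) := by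
  refine ⟨isHermitian_totalHamiltonian hA.1 hB.1, ?_⟩
  have h1 := congrArg (· ⊗ₖ σ) hA.2
  have h2 := congrArg (ρ ⊗ₖ ·) hB.2
  simp only [add_kronecker, kronecker_add, smul_kronecker, kronecker_smul, sub_eq_add_neg,
    ← neg_one_smul ℂ (HA * ρ), ← neg_one_smul ℂ (HB * σ)] at h1 h2
  simp only [totalHamiltonian, Matrix.add_mul, Matrix.mul_add, ← mul_kronecker_mul,
    Matrix.one_mul, Matrix.mul_one]
  calc _ = ((LA * ρ) ⊗ₖ σ + (ρ * LA) ⊗ₖ σ) + (ρ ⊗ₖ (LB * σ) + ρ ⊗ₖ (σ * LB)) := by abel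
    _ = _ := by rw [h1, h2]; module

lemma trace_mul_totalHamiltonian (Y : Matrix (m × n) (m × n) ℂ) (A : Matrix m m ℂ)
    (B : Matrix n n ℂ) :
    (Y * totalHamiltonian A B).trace = (reducedLeft Y * A).trace + (reducedRight Y * B).trace := by
  rw [totalHamiltonian, Matrix.mul_add, trace_add, trace_mul_kronecker_one,
    trace_mul_one_kronecker]

lemma trace_mul_totalHamiltonian_sq (Y : Matrix (m × n) (m × n) ℂ) (A : Matrix m m ℂ)
    (B : Matrix n n ℂ) :
    (Y * (totalHamiltonian A B * totalHamiltonian A B)).trace =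
      (reducedLeft Y * (A * A)).trace + (reducedRight Y * (B * B)).trace
        + 2 * (Y * (A ⊗ₖ B)).trace := by
  rw [← trace_mul_kronecker_one, ← trace_mul_one_kronecker]
  simp only [totalHamiltonian, Matrix.add_mul, Matrix.mul_add, ← mul_kronecker_mul,
    Matrix.one_mul, Matrix.mul_one, trace_add]
  ring

/-- For a local Hamiltonian and a local observable, the rate of change of the expectation value
depends only on the reduced states; here it is written through their logarithmic derivatives. -/
lemma trace_commutator_mul_totalHamiltonian {HA LA : Matrix m m ℂ} {HB LB : Matrix n n ℂ}
    {Y : Matrix (m × n) (m × n) ℂ} (hA : IsSLD HA (reducedLeft Y) LA)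
    (hB : IsSLD HB (reducedRight Y) LB) :
    (((2 * I) • (Y * totalHamiltonian HA HB - totalHamiltonian HA HB * Y))
        * totalHamiltonian LA LB).trace
      = 2 * (reducedLeft Y * (LA * LA)).trace + 2 * (reducedRight Y * (LB * LB)).trace := by
  have hcomm : totalHamiltonian HA HB * totalHamiltonian LA LB
      - totalHamiltonian LA LB * totalHamiltonian HA HB
      = totalHamiltonian (HA * LA - LA * HA) (HB * LB - LB * HB) := by
    simp only [totalHamiltonian, Matrix.add_mul, Matrix.mul_add, ← mul_kronecker_mul,
      Matrix.one_mul, Matrix.mul_one, sub_eq_add_neg, add_kronecker, kronecker_add,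
      ← neg_one_smul ℂ (LA * HA), ← neg_one_smul ℂ (LB * HB), smul_kronecker, kronecker_smul]
    module
  rw [trace_commutator_mul, hcomm, trace_mul_totalHamiltonian, mul_add, hA.trace_commutator,
    hB.trace_commutator]

end LogarithmicDerivative

/-! ### Joint states with a pure reduced state -/

section Purity

variable {m n : Type*} [Fintype m] [DecidableEq m] [Fintype n] [DecidableEq n]

open scoped CStarAlgebra MatrixOrder Matrix.Norms.L2Operator in
lemma Matrix.PosSemidef.mul_eq_zero_of_trace {ω Q : Matrix n n ℂ} (hω : ω.PosSemidef)
    (h : (Qᴴ * ω * Q).trace = 0) : ω * Q = 0 := by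
  obtain ⟨B, hB⟩ := CStarAlgebra.nonneg_iff_eq_star_mul_self.mp hω.nonneg
  rw [Matrix.star_eq_conjTranspose] at hB
  have h0 : B * Q = 0 := by
    rw [← Matrix.trace_conjTranspose_mul_self_eq_zero_iff, ← h, hB]
    simp only [conjTranspose_mul, Matrix.mul_assoc]
  rw [hB, Matrix.mul_assoc, h0, Matrix.mul_zero]

/-- If one reduced state is a pure state `P`, the joint state lives on the range of `P ⊗ 1`. -/
lemma mul_kronecker_one_eq_self {ω : Matrix (m × n) (m × n) ℂ} (hω : ω.PosSemidef)
    (hP : (reducedLeft ω).IsHermitian) (hPP : reducedLeft ω * reducedLeft ω = reducedLeft ω) :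
    ω * (reducedLeft ω ⊗ₖ (1 : Matrix n n ℂ)) = ω := by
  set P := reducedLeft ω with hPdef
  have h : ω * ((1 - P) ⊗ₖ (1 : Matrix n n ℂ)) = 0 := by
    apply hω.mul_eq_zero_of_trace
    rw [conjTranspose_kronecker, Matrix.mul_assoc, Matrix.trace_mul_comm, Matrix.mul_assoc,
      ← mul_kronecker_mul]
    simp only [conjTranspose_sub, conjTranspose_one, hP.eq, Matrix.one_mul]
    rw [trace_mul_kronecker_one, ← hPdef]
    simp [Matrix.mul_sub, Matrix.sub_mul, hPP]
  have h1 : (1 : Matrix m m ℂ) = (1 - P) + P := by simp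
  calc _ = ω * ((1 - P) ⊗ₖ (1 : Matrix n n ℂ)) + ω * (P ⊗ₖ (1 : Matrix n n ℂ)) := by
        rw [h, zero_add]
    _ = ω := by rw [← Matrix.mul_add, ← add_kronecker, ← h1, one_kronecker_one, Matrix.mul_one]

/-- A pure reduced state forbids correlations, so an observable `A` of mean zero on it gives
`A ⊗ B` mean zero. -/
lemma trace_mul_kronecker_eq_zero {ω : Matrix (m × n) (m × n) ℂ} (hω : ω.PosSemidef)
    (hP : (reducedLeft ω).IsHermitian) (hPP : reducedLeft ω * reducedLeft ω = reducedLeft ω)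
    {A : Matrix m m ℂ} (hA : reducedLeft ω * A * reducedLeft ω = 0) (B : Matrix n n ℂ) :
    (ω * (A ⊗ₖ B)).trace = 0 := by
  have h1 := mul_kronecker_one_eq_self hω hP hPP
  have h2 : (reducedLeft ω ⊗ₖ (1 : Matrix n n ℂ)) * ω = ω := by
    have := congrArg conjTranspose h1
    rwa [conjTranspose_mul, conjTranspose_kronecker, hP.eq, conjTranspose_one, hω.1.eq] at this
  rw [← h1]
  nth_rewrite 1 [← h2]
  rw [Matrix.mul_assoc, Matrix.mul_assoc, Matrix.trace_mul_comm, Matrix.mul_assoc,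
    Matrix.mul_assoc, ← mul_kronecker_mul, ← mul_kronecker_mul, Matrix.mul_one, Matrix.one_mul,
    ← Matrix.mul_assoc, hA, zero_kronecker, Matrix.mul_zero, trace_zero]

end Purity

/-! ### Monotonicity of the quantum Fisher information -/

section Monotonicity

variable {m : Type*} [Fintype m] [DecidableEq m]

lemma IsCompletelyPositive.map_posSemidef {n : Type*} [Fintype n] [DecidableEq n]
    {E : Matrix n n ℂ →ₗ[ℂ] Matrix n n ℂ} (hE : IsCompletelyPositive E) {τ : Matrix n n ℂ}
    (hτ : τ.PosSemidef) : (E τ).PosSemidef := by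
  simpa using hE.posSemidef_sum (k := 1) hτ (fun _ => 1) (fun _ => 1)

/-- A catalytic conversion into a pure state cannot increase the quantum Fisher information. The
Fisher information of the catalyst is finite and occurs on both sides, so it cancels. -/
lemma CCTIOConvertible.fisher_le {HS ρ ρ' Lρ Lρ' : Matrix m m ℂ}
    (h : CCTIOConvertible HS ρ ρ') (hρ : IsDensityMatrix ρ) (hL : IsSLD HS ρ Lρ)
    (hL' : IsSLD HS ρ' Lρ') (hpure : ρ' * ρ' = ρ') (hmean : ρ' * Lρ' * ρ' = 0) :
    (ρ' * (Lρ' * Lρ')).trace ≤ (ρ * (Lρ * Lρ)).trace := by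
  obtain ⟨d, HC, σ, E, hHC, hσ, hE, hS, hC⟩ := h
  obtain ⟨Lσ, hLσ⟩ := exists_isSLD hHC hσ.1
  have hτ : (ρ ⊗ₖ σ).PosSemidef := hρ.1.kronecker hσ.1
  have hω := hE.1.1.map_posSemidef hτ
  have hLτ := hL.kronecker hLσ
  have hX := isHermitian_totalHamiltonian hL'.1 hLσ.1
  -- The observable tested on the output is the logarithmic derivative of the product `ρ' ⊗ σ`.
  have key := hE.1.trace_variational hτ hLτ.1 hX
  have hρ'h : ρ'.IsHermitian := by
    rw [← hS]
    ext i j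
    simp only [reducedLeft, conjTranspose_apply, Matrix.of_apply, star_sum]
    exact Finset.sum_congr rfl fun k _ => hω.1.apply _ _
  have hcross : (E (ρ ⊗ₖ σ) * (Lρ' ⊗ₖ Lσ)).trace = 0 := by
    apply trace_mul_kronecker_eq_zero hω <;> rw [hS] <;> assumption
  have hcross' : ((ρ ⊗ₖ σ) * (Lρ ⊗ₖ Lσ)).trace = 0 := by
    rw [← mul_kronecker_mul, trace_kronecker, hL.trace_mul_eq_zero, zero_mul]
  have hlin := trace_commutator_mul_totalHamiltonian (Y := E (ρ ⊗ₖ σ)) (hS.symm ▸ hL')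
    (hC.symm ▸ hLσ)
  rw [hLτ.anticommutator, map_smul, hE.map_commutator, hlin, trace_mul_totalHamiltonian_sq,
    trace_mul_totalHamiltonian_sq, hcross, hcross', reducedLeft_kronecker, reducedRight_kronecker,
    hS, hC, hρ.2, hσ.2, one_smul, one_smul] at key
  rw [← sub_nonneg]
  convert key using 1
  ring

end Monotonicity

/-! ### Qubit states -/

section Qubit

lemma rhoPlus_eq : rhoPlus = !![1 / 2, 1 / 2; 1 / 2, 1 / 2] := by
  ext i j
  fin_cases i <;> fin_cases j <;> simp [rhoPlus, pauliX]

lemma qubitHamiltonian_eq (Δ : ℝ) :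
    qubitHamiltonian Δ = !![(Δ / 2 : ℂ), 0; 0, -(Δ / 2 : ℂ)] := by
  ext i j
  fin_cases i <;> fin_cases j <;> simp [qubitHamiltonian, pauliZ]

/-- The matrix `2 dρ/dt = -2 i [H, ρ]`, which for a qubit state is itself a symmetric logarithmic
derivative: it is off-diagonal, so its anticommutator with `ρ` is `tr ρ` times itself. -/
noncomputable def qubitSLD (Δ : ℝ) (ρ : Matrix (Fin 2) (Fin 2) ℂ) : Matrix (Fin 2) (Fin 2) ℂ :=
  !![0, -(2 * I * Δ * ρ 0 1); 2 * I * Δ * ρ 1 0, 0]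

lemma isSLD_qubitSLD (Δ : ℝ) {ρ : Matrix (Fin 2) (Fin 2) ℂ} (hρ : ρ.IsHermitian)
    (htr : ρ.trace = 1) : IsSLD (qubitHamiltonian Δ) ρ (qubitSLD Δ ρ) := by
  rw [trace_fin_two] at htr
  have h01 : (starRingEnd ℂ) (ρ 0 1) = ρ 1 0 := hρ.apply 1 0
  have h10 : (starRingEnd ℂ) (ρ 1 0) = ρ 0 1 := hρ.apply 0 1
  constructor
  · ext i j
    fin_cases i <;> fin_cases j <;> simp [qubitSLD, h01, h10]
  · rw [qubitHamiltonian_eq]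
    ext i j
    fin_cases i <;> fin_cases j <;>
      simp [qubitSLD, Matrix.mul_apply, Matrix.vecMul, dotProduct, Fin.sum_univ_two]
    · ring
    · linear_combination (-2 * I * Δ * ρ 0 1) * htr
    · linear_combination (2 * I * Δ * ρ 1 0) * htr
    · ring

lemma trace_mul_qubitSLD_sq (Δ : ℝ) {ρ : Matrix (Fin 2) (Fin 2) ℂ} (htr : ρ.trace = 1) :
    (ρ * (qubitSLD Δ ρ * qubitSLD Δ ρ)).trace = 4 * (Δ : ℂ) ^ 2 * (ρ 0 1 * ρ 1 0) := by
  rw [trace_fin_two] at htr ⊢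
  simp [qubitSLD, Matrix.mul_apply, Fin.sum_univ_two]
  linear_combination (4 * Δ ^ 2 * ρ 0 1 * ρ 1 0) * htr
    - (4 * Δ ^ 2 * ρ 0 1 * ρ 1 0 * (ρ 0 0 + ρ 1 1)) * I_sq

/-- A qubit state whose coherence is at least that of `ρ⁺` is on the equator of the Bloch sphere,
and a rotation about the `z` axis takes `ρ⁺` to it. -/
lemma symmetricUnitaryEquivalent_of_quarter_le (Δ : ℝ) {ρ : Matrix (Fin 2) (Fin 2) ℂ}
    (hρ : IsDensityMatrix ρ) (h : 1 / 4 ≤ ρ 0 1 * ρ 1 0) :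
    SymmetricUnitaryEquivalent (qubitHamiltonian Δ) ρ rhoPlus := by
  have h01 : (starRingEnd ℂ) (ρ 0 1) = ρ 1 0 := hρ.1.1.apply 1 0
  have htr := hρ.2
  rw [trace_fin_two] at htr
  have hdet := hρ.1.det_nonneg
  rw [det_fin_two] at hdet
  have hs : ρ 1 1 = 1 - ρ 0 0 := by linear_combination htr
  obtain ⟨r, hr⟩ : ∃ r : ℝ, ρ 0 0 = r :=
    ⟨(ρ 0 0).re, Complex.ext rfl (conj_eq_iff_im.1 (hρ.1.1.apply 0 0))⟩
  rw [← h01, mul_conj] at h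
  rw [← h01, mul_conj, hs, hr] at hdet
  have h' : (1 / 4 : ℝ) ≤ normSq (ρ 0 1) := by
    rw [← Complex.real_le_real]
    push_cast
    exact h
  have hdet' : 0 ≤ r * (1 - r) - normSq (ρ 0 1) := by exact_mod_cast hdet
  -- `1 / 4 ≤ |ρ 0 1| ^ 2 ≤ r (1 - r) ≤ 1 / 4` forces equality throughout.
  have hr2 : r = 1 / 2 := by nlinarith [sq_nonneg (r - 1 / 2)]
  have hn : normSq (ρ 0 1) = 1 / 4 := by subst hr2; linarith
  have hn' : ρ 0 1 * ρ 1 0 = 1 / 4 := by rw [← h01, mul_conj, hn]; norm_num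
  have h2 : (starRingEnd ℂ) 2 = 2 := map_ofNat _ 2
  refine ⟨!![2 * ρ 0 1, 0; 0, 1], ?_, ?_, ?_⟩
  · rw [Matrix.mem_unitaryGroup_iff]
    ext i j
    fin_cases i <;> fin_cases j <;>
      simp [Matrix.mul_apply, Fin.sum_univ_two, Matrix.star_apply, h01, h2]
    linear_combination 4 * hn'
  · rw [qubitHamiltonian_eq, Commute, SemiconjBy]
    ext i j
    fin_cases i <;> fin_cases j <;> simp [Matrix.mul_apply, Fin.sum_univ_two, mul_comm]
  · rw [rhoPlus_eq]
    ext i j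
    fin_cases i <;> fin_cases j <;>
      simp [Matrix.mul_apply, Fin.sum_univ_two, Matrix.star_apply, h01, h2]
    · rw [hr, hr2]; push_cast; linear_combination -2 * hn'
    · ring
    · rw [hs, hr, hr2]; norm_num

end Qubit

/-! ### Conjugation by symmetric unitaries -/

section SymmetricUnitary

lemma commute_star_of_mem_unitaryGroup {n : Type*} [Fintype n] [DecidableEq n]
    {U H : Matrix n n ℂ} (hU : U ∈ Matrix.unitaryGroup n ℂ) (hUH : Commute U H) :
    Commute (star U) H := by
  calc star U * H = star U * (H * U) * star U := by
        rw [Matrix.mul_assoc, Matrix.mul_assoc, (Matrix.mem_unitaryGroup_iff).1 hU, Matrix.mul_one]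
    _ = H * star U := by
        rw [← hUH.eq, ← Matrix.mul_assoc, (Matrix.mem_unitaryGroup_iff').1 hU, Matrix.one_mul]

/-- Conjugation by a unitary that commutes with the Hamiltonian is translationally invariant. -/
lemma isTIO_conj_unitary {n : Type*} [Fintype n] [DecidableEq n] {H V : Matrix n n ℂ}
    (hV : V ∈ Matrix.unitaryGroup n ℂ) (hVH : Commute V H) :
    IsTIO H (LinearMap.mulLeftRight ℂ (V, star V)) := by
  have hVV : star V * V = 1 := (Matrix.mem_unitaryGroup_iff').1 hV
  have hVH' := commute_star_of_mem_unitaryGroup hV hVH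
  refine ⟨⟨(isCompletelyPositive_iff _).2 fun k M hM => ?_, fun X => ?_⟩, fun t X => ?_⟩
  -- The extension `id ⊗ E` is conjugation by `1 ⊗ V`.
  · convert hM.mul_mul_conjTranspose_same ((1 : Matrix (Fin k) (Fin k) ℂ) ⊗ₖ V) using 1
    ext p q
    simp [Matrix.mul_apply, Fintype.sum_prod_type, Matrix.one_apply, Matrix.star_apply,
      Finset.sum_mul, LinearMap.mulLeftRight_apply, apply_ite (starRingEnd ℂ)]
  · rw [LinearMap.mulLeftRight_apply, Matrix.trace_mul_comm, ← Matrix.mul_assoc, hVV,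
      Matrix.one_mul]
  · have h1 := (hVH.smul_right (-(I * (t : ℂ)))).exp_right
    have h2 := (hVH'.smul_right (I * (t : ℂ))).exp_right
    simp only [LinearMap.mulLeftRight_apply, freeEvolution]
    simp only [← Matrix.mul_assoc]
    rw [h1.eq]
    simp only [Matrix.mul_assoc]
    rw [h2.eq]

/-- The trivial one-dimensional catalyst suffices. -/
lemma SymmetricUnitaryEquivalent.cctioConvertible {m : Type*} [Fintype m] [DecidableEq m]
    {H ρ ρ' : Matrix m m ℂ} (h : SymmetricUnitaryEquivalent H ρ ρ') (hρ : IsDensityMatrix ρ) :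
    CCTIOConvertible H ρ ρ' := by
  obtain ⟨U, hU, hUH, rfl⟩ := h
  have hUU : star U * U = 1 := (Matrix.mem_unitaryGroup_iff').1 hU
  have hUH' := commute_star_of_mem_unitaryGroup hU hUH
  have htr : ρ'.trace = 1 := by
    rw [← hρ.2, Matrix.trace_mul_comm, ← Matrix.mul_assoc, hUU, Matrix.one_mul]
  let V : Matrix (m × Fin 1) (m × Fin 1) ℂ := star U ⊗ₖ 1
  have hVs : star V = U ⊗ₖ 1 := by
    simp [V, Matrix.star_eq_conjTranspose, conjTranspose_kronecker]
  have hV : V ∈ Matrix.unitaryGroup (m × Fin 1) ℂ := by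
    rw [Matrix.mem_unitaryGroup_iff, hVs, ← mul_kronecker_mul, hUU, Matrix.one_mul,
      one_kronecker_one]
  have hVH : Commute V (totalHamiltonian H 0) := by
    simp only [V, totalHamiltonian, Commute, SemiconjBy, Matrix.mul_add, Matrix.add_mul,
      ← mul_kronecker_mul, hUH'.eq, Matrix.mul_zero, Matrix.zero_mul, kronecker_zero]
  have hout : LinearMap.mulLeftRight ℂ (V, star V) ((U * ρ' * star U) ⊗ₖ 1) = ρ' ⊗ₖ 1 := by
    rw [LinearMap.mulLeftRight_apply, hVs, ← mul_kronecker_mul, ← mul_kronecker_mul]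
    congr 1
    · calc _ = (star U * U) * ρ' * (star U * U) := by simp only [Matrix.mul_assoc]
        _ = ρ' := by simp [hUU]
    · simp
  refine ⟨1, 0, 1, LinearMap.mulLeftRight ℂ (V, star V), Matrix.isHermitian_zero,
    ⟨Matrix.PosSemidef.one, by simp⟩, isTIO_conj_unitary hV hVH, ?_, ?_⟩
  · rw [hout, reducedLeft_kronecker]; simp
  · rw [hout, reducedRight_kronecker, htr, one_smul]

end SymmetricUnitary

theorem mainTheorem5 (Δ : ℝ) (hΔ : 0 < Δ)
    (ρ : Matrix (Fin 2) (Fin 2) ℂ) (hρ : IsDensityMatrix ρ) :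
    CCTIOConvertible (qubitHamiltonian Δ) ρ rhoPlus ↔
      SymmetricUnitaryEquivalent (qubitHamiltonian Δ) ρ rhoPlus := by
  refine ⟨fun h => symmetricUnitaryEquivalent_of_quarter_le Δ hρ ?_,
    fun h => h.cctioConvertible hρ⟩
  have htr : rhoPlus.trace = 1 := by simp [rhoPlus_eq, trace_fin_two]; norm_num
  have hherm : rhoPlus.IsHermitian := by
    rw [rhoPlus_eq]
    ext i j
    fin_cases i <;> fin_cases j <;> simp
  have hpure : rhoPlus * rhoPlus = rhoPlus := by
    rw [rhoPlus_eq]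
    ext i j
    fin_cases i <;> fin_cases j <;> simp [Matrix.mul_apply, Fin.sum_univ_two] <;> norm_num
  have hmean : rhoPlus * qubitSLD Δ rhoPlus * rhoPlus = 0 := by
    rw [rhoPlus_eq]
    ext i j
    fin_cases i <;> fin_cases j <;>
      simp [qubitSLD, Matrix.mul_apply, Fin.sum_univ_two]
  have key := h.fisher_le hρ (isSLD_qubitSLD Δ hρ.1.1 hρ.2) (isSLD_qubitSLD Δ hherm htr)
    hpure hmean
  rw [trace_mul_qubitSLD_sq Δ hρ.2, trace_mul_qubitSLD_sq Δ htr] at key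
  have hpos : (0 : ℂ) < 4 * (Δ : ℂ) ^ 2 := by
    have : (0 : ℝ) < 4 * Δ ^ 2 := by positivity
    exact_mod_cast this
  have hval : rhoPlus 0 1 * rhoPlus 1 0 = 1 / 4 := by simp [rhoPlus_eq]; norm_num
  rw [hval] at key
  exact le_of_mul_le_mul_left key hpos
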